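/- Let $G$ be a finite abelian group and write $\mu_G(A)=|A|/|G|$ for $A\subseteq G$. A Bohr set $B$ in $G$ is given by a set $\Gamma$ of characters $\gamma:G\to S^1$ together with a width function $w:\Gamma\to(0,2]$; for $\rho>0$ put $$B_\rho=\{x\in G:\ |1-\gamma(x)|\le \rho\, w(\gamma)\ \text{for all }\gamma\in\Gamma\},$$ and, for $A\subseteq G$, $\beta_\rho(A)=\mu_G(A\cap B_\rho)/\mu_G(B_\rho)$. A $d$-dimensional coset progression in $G$ is a set of the form $$M=a+H+\{l_1x_1+\dots+l_dx_d:\ 0\le l_i<N_i,\ l_i\in\mathbb{Z},\ 1\le i\le d\}$$ with $H\le G$ a subgroup, $a,x_1,\dots,x_d\in G$ and integers $N_1,\dots,N_d\ge 1$; it is proper if $|M|=|H|N_1\cdots N_d$. There is an absolute constant $C>0$ such that the following holds. Let $G$ be a finite abelian group, $B$ a Bohr set in $G$, $d\ge 0$ an integer and $\delta$ a real number with $0<\delta<\frac{1}{4(3d+1)}$ such that $$\mu_G(B_{(3d+1)\delta})<2^d\mu_G(B_\delta).$$ Then $B_\delta$ contains a proper $d$-dimensional coset progression $M$ with $$\beta_\delta(M)\ge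 \exp(-C\,d\log d)$$ (for $d=0$ the hypothesis is never satisfied). -/

import Mathlib

/-- A Bohr set in a finite abelian group, with its frequency set (a set of characters, i.e.
homomorphisms into the unit circle) and its width function `Γ → (0, 2]` fixed as data. -/
structure BohrSet (G : Type*) [AddCommGroup G] where
  freq : Set (AddChar G Circle)
  width : freq → ℝ
  width_pos : ∀ γ, 0 < width γ
  width_le_two : ∀ γ, width γ ≤ 2

namespace BohrSet

variable {G : Type*} [AddCommGroup G]

/-- The underlying set `{x : |1 - γ(x)| ≤ δ_γ for all γ ∈ Γ}`. -/
def carrier (B : BohrSet G) : Set G :=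
  {x | ∀ γ : B.freq, ‖(1 : ℂ) - (γ.1 x : ℂ)‖ ≤ B.width γ}

/-- The dilate `B_ρ`, `ρ > 0`: same frequency set, width function `γ ↦ min (ρ δ_γ) 2`. -/
noncomputable def dilate (B : BohrSet G) (ρ : ℝ) (hρ : 0 < ρ) : BohrSet G where
  freq := B.freq
  width γ := min (ρ * B.width γ) 2
  width_pos γ := lt_min (mul_pos hρ (B.width_pos γ)) two_pos
  width_le_two _ := min_le_right _ _

end BohrSet

/-- The Haar probability measure `μ_G` of a finite group, i.e. the uniform one. -/
noncomputable def haarProb {G : Type*} (A : Set G) : ℝ :=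
  (A.ncard : ℝ) / (Nat.card G : ℝ)

/-- The probability measure `β` induced on a Bohr set by `μ_G`. -/
noncomputable def BohrSet.beta {G : Type*} [AddCommGroup G] (B : BohrSet G) (A : Set G) : ℝ :=
  haarProb (A ∩ B.carrier) / haarProb B.carrier

/-- The data of a `d`-dimensional coset progression
`a + H + {l₁ x₁ + ⋯ + l_d x_d : 0 ≤ l_i < N_i}`, with `H` a subgroup and `N_i ≥ 1`. -/
structure CosetProgression (G : Type*) [AddCommGroup G] (d : ℕ) where
  subgroup : AddSubgroup G
  base : G
  step : Fin d → G
  length : Fin d → ℕ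
  length_pos : ∀ i, 0 < length i

namespace CosetProgression

variable {G : Type*} [AddCommGroup G] {d : ℕ}

/-- The point of the progression with coordinates `h ∈ H` and `0 ≤ l_i < N_i`. -/
def point (M : CosetProgression G d) (p : M.subgroup × ((i : Fin d) → Fin (M.length i))) : G :=
  M.base + (p.1 : G) + ∑ i, (p.2 i : ℕ) • M.step i

/-- The underlying set of the coset progression. -/
def carrier (M : CosetProgression G d) : Set G := Set.range M.point

/-- Proper: all the sums are distinct, i.e. the set has size `|H| N₁ ⋯ N_d`. -/
def IsProper (M : CosetProgression G d) : Prop := Function.Injective M.point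

end CosetProgression

theorem dilation_pos (d : ℕ) {δ : ℝ} (hδ : 0 < δ) : 0 < (3 * (d : ℝ) + 1) * δ := by
  positivity

/-! Write `D` for `B_δ` and `K` for the common kernel of its characters. Taking arguments of the `γ
x`, in units of the arc half-angles of `D`, turns the problem into one about the group `L` of lifts
in `ℝ^Γ` with the sup norm. Since `δ` is small, lifts of norm at most `3d+1` determine their angles
without wrap-around. Hence `|D| ≤ |K| · #{θ ∈ L : ‖θ‖ ≤ 1}` (`ncard_carrier_le`) and `|K| · #{θ ∈ L
: ‖θ‖ ≤ 3d+1} ≤ |B_{(3d+1)δ}|` (`card_kernel_mul_ncard_lifts_le`), so the ball counts of `L` inherit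
the growth factor below `2^d`.

Small growth bounds dimension: `d` vectors with separated subset sums would give `2^d` disjoint
translates of the unit ball, and a maximal separated family spans all short vectors
(`finrank_span_lt_of_ncard_lt`). So the short vectors span dimension `n < d`.

Geometry of numbers then applies. Choose successive minima `v k`; a basis of `L` adapted to their
flag bounds the unit ball count by about `∏ 1/‖v k‖` (`ncard_le_prod`), while the progression with
steps `v k` and lengths about `1/(n‖v k‖)` lies in the ball and is proper by linear independence.
The loss is at most `(4n)^n ≤ d^(3d)`. Projecting to `G` and adding `K` gives the coset progression,
with `C = 3`. -/

/-! ### Dimension of the short vectors of a discrete group with small growth -/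

/-- `y 0, …, y (k - 1)` have norm at most `3`, and no nontrivial combination of them with
coefficients in `{-1, 0, 1}` has norm at most `2`. -/
structure IsSeparatedFamily {E : Type*} [NormedAddCommGroup E] (L : AddSubgroup E) (k : ℕ)
    (y : Fin k → E) : Prop where
  mem : ∀ i, y i ∈ L
  norm_le : ∀ i, ‖y i‖ ≤ 3
  eq_zero : ∀ e : Fin k → ℤ, (∀ i, |e i| ≤ 1) → ‖∑ i, e i • y i‖ ≤ 2 → e = 0

section Separated

variable {E : Type*} [NormedAddCommGroup E] {L : AddSubgroup E}

/-- The unit balls around the subset sums are disjoint: two points of the unit ball differ by norm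
at most `2`, and two subset sums differ by coefficients in `{-1, 0, 1}`. -/
theorem IsSeparatedFamily.two_pow_mul_ncard_le {k : ℕ} {y : Fin k → E}
    (hy : IsSeparatedFamily L k y) (hfin : {x | x ∈ L ∧ ‖x‖ ≤ 3 * (k : ℝ) + 1}.Finite) :
    2 ^ k * {x | x ∈ L ∧ ‖x‖ ≤ 1}.ncard ≤ {x | x ∈ L ∧ ‖x‖ ≤ 3 * (k : ℝ) + 1}.ncard := by
  classical
  set A := {x | x ∈ L ∧ ‖x‖ ≤ 1}
  have hcard : ((Set.univ : Set (Fin k → Bool)) ×ˢ A).ncard = 2 ^ k * A.ncard := by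
    rw [Set.ncard_prod]; simp [Set.ncard_univ]
  rw [← hcard]
  refine Set.ncard_le_ncard_of_injOn
    (fun p => (∑ i, (if p.1 i then (1 : ℤ) else 0) • y i) + p.2) ?_ ?_ hfin
  · rintro ⟨s, a⟩ ⟨-, haL, ha⟩
    refine ⟨L.add_mem (L.sum_mem fun i _ => L.zsmul_mem (hy.mem i) _) haL, ?_⟩
    have h1 : ‖∑ i, (if s i then (1 : ℤ) else 0) • y i‖ ≤ ∑ _i : Fin k, (3 : ℝ) := by
      refine (norm_sum_le _ _).trans (Finset.sum_le_sum fun i _ => ?_)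
      split_ifs
      · simpa using hy.norm_le i
      · simp
    simp only [Finset.sum_const, Finset.card_univ, Fintype.card_fin, nsmul_eq_mul] at h1
    exact (norm_add_le _ _).trans (by dsimp only at ha ⊢; linarith)
  · rintro ⟨s, a⟩ ⟨-, haL, ha⟩ ⟨t, b⟩ ⟨-, hbL, hb⟩ h
    dsimp only at h ha hb
    have hdiff : ∑ i, ((if s i then (1 : ℤ) else 0) - (if t i then (1 : ℤ) else 0)) • y i
        = b - a := by
      simp only [sub_smul, Finset.sum_sub_distrib]
      rw [sub_eq_sub_iff_add_eq_add, h, add_comm]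
    have h0 := hy.eq_zero (fun i => (if s i then (1 : ℤ) else 0) - (if t i then (1 : ℤ) else 0))
      (fun i => by split_ifs <;> simp)
      (by rw [hdiff]; exact (norm_sub_le _ _).trans (by linarith))
    have hst : s = t := by
      funext i
      have := congrFun h0 i
      cases hs : s i <;> cases ht : t i <;> simp [hs, ht] at this ⊢
    subst hst
    simpa using h

variable [NormedSpace ℝ E]

/-- By maximality, every vector of `L` of norm at most `3` is congruent modulo the span to one of
norm at most `2`. A functional `f` vanishing on the span with `f u > 0` would then have no maximum
on the ball of radius `3 = 2 + 1`: replace a maximiser by its short representative and add `u`. -/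
theorem IsSeparatedFamily.mem_span_of_maximal {k : ℕ} {y : Fin k → E}
    (hy : IsSeparatedFamily L k y) (hmax : ∀ z, ¬ IsSeparatedFamily L (k + 1) z)
    (hfin : {x | x ∈ L ∧ ‖x‖ ≤ 3}.Finite) {u : E} (hu : u ∈ L) (hu1 : ‖u‖ ≤ 1) :
    u ∈ Submodule.span ℝ (Set.range y) := by
  by_contra hus
  have hcover : ∀ x ∈ L, ‖x‖ ≤ 3 → ∃ z ∈ L, ‖z‖ ≤ 2 ∧
      x - z ∈ Submodule.span ℝ (Set.range y) := by
    intro x hx hx3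
    have hnot := hmax (Fin.cons x y)
    have hex : ∃ e : Fin (k + 1) → ℤ, (∀ i, |e i| ≤ 1) ∧
        ‖∑ i, e i • (Fin.cons x y : Fin (k + 1) → E) i‖ ≤ 2 ∧ e ≠ 0 := by
      by_contra! hcon
      exact hnot ⟨fun i => by cases i using Fin.cases <;> simp [hx, hy.mem],
        fun i => by cases i using Fin.cases <;> simp [hx3, hy.norm_le], hcon⟩
    obtain ⟨e, he, hle, hne⟩ := hex
    rw [Fin.sum_univ_succ] at hle
    simp only [Fin.cons_zero, Fin.cons_succ] at hle
    have hspan : ∀ c : Fin k → ℤ, ∑ i, c i • y i ∈ Submodule.span ℝ (Set.range y) := fun c =>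
      Submodule.sum_mem _ fun i _ => zsmul_mem (Submodule.subset_span (Set.mem_range_self i)) _
    have hL : ∑ i : Fin k, e i.succ • y i ∈ L := L.sum_mem fun i _ => L.zsmul_mem (hy.mem i) _
    -- A relation not involving `x` would contradict the separation of `y`; so `x` occurs with
    -- coefficient `±1` and can be solved for.
    have he0 : e 0 ≠ 0 := by
      intro h0
      have := hy.eq_zero (fun i => e i.succ) (fun i => he _) (by simpa [h0] using hle)
      exact hne (funext (Fin.cases h0 fun i => congrFun this i))
    have h1 := abs_le.mp (he 0)
    rcases (by omega : e 0 = 1 ∨ e 0 = -1) with h | h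
    · refine ⟨x + ∑ i : Fin k, e i.succ • y i, L.add_mem hx hL, by simpa [h] using hle, ?_⟩
      simpa using hspan fun i => e i.succ
    · refine ⟨x - ∑ i : Fin k, e i.succ • y i, L.sub_mem hx hL, ?_, ?_⟩
      · rw [norm_sub_rev, sub_eq_neg_add]; simpa [h] using hle
      · simpa using hspan fun i => e i.succ
  obtain ⟨f, hfu, hf⟩ := Submodule.exists_le_ker_of_notMem hus
  wlog hpos : 0 < f u generalizing u f
  · refine this (u := -u) (L.neg_mem hu) (by simpa using hu1) (by simpa using hus) f
      (by simpa using hfu) hf ?_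
    rw [map_neg]
    exact neg_pos.mpr (lt_of_le_of_ne (not_lt.mp hpos) hfu)
  obtain ⟨x, ⟨hxL, hx3⟩, hxmax⟩ := Set.exists_max_image _ f hfin ⟨0, L.zero_mem, by simp⟩
  obtain ⟨z, hzL, hz2, hxz⟩ := hcover x hxL hx3
  have h1 : f x - f z = 0 := by rw [← map_sub]; exact hf hxz
  have h2 := hxmax (z + u) ⟨L.add_mem hzL hu, (norm_add_le _ _).trans (by linarith)⟩
  rw [map_add] at h2
  linarith

theorem finrank_span_lt_of_ncard_lt {d : ℕ}
    (hfin : {x | x ∈ L ∧ ‖x‖ ≤ 3 * (d : ℝ) + 1}.Finite)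
    (hlt : {x | x ∈ L ∧ ‖x‖ ≤ 3 * (d : ℝ) + 1}.ncard < 2 ^ d * {x | x ∈ L ∧ ‖x‖ ≤ 1}.ncard) :
    Module.finrank ℝ (Submodule.span ℝ {x | x ∈ L ∧ ‖x‖ ≤ 1}) < d := by
  have hd : ¬ ∃ y, IsSeparatedFamily L d y := fun ⟨y, hy⟩ =>
    hlt.not_ge (hy.two_pow_mul_ncard_le hfin)
  obtain ⟨k, hkd, ⟨y, hy⟩, hmax⟩ : ∃ k < d, (∃ y, IsSeparatedFamily L k y) ∧
      ¬ ∃ y, IsSeparatedFamily L (k + 1) y := by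
    by_contra! hcon
    have : ∀ k ≤ d, ∃ y, IsSeparatedFamily L k y := by
      intro k
      induction k with
      | zero => exact fun _ => ⟨Fin.elim0, fun i => i.elim0, fun i => i.elim0,
          fun e _ _ => Subsingleton.elim _ _⟩
      | succ k ih => exact fun hk => hcon k hk (ih (by omega))
    exact hd (this d le_rfl)
  have hd1 : (1 : ℝ) ≤ d := by exact_mod_cast (by omega : 1 ≤ d)
  have hle : Submodule.span ℝ {x | x ∈ L ∧ ‖x‖ ≤ 1} ≤ Submodule.span ℝ (Set.range y) :=
    Submodule.span_le.mpr fun u hu => hy.mem_span_of_maximal (fun z hz => hmax ⟨z, hz⟩)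
      (hfin.subset fun x hx => ⟨hx.1, hx.2.trans (by linarith)⟩) hu.1 hu.2
  have : FiniteDimensional ℝ (Submodule.span ℝ (Set.range y)) :=
    FiniteDimensional.span_of_finite ℝ (Set.finite_range y)
  calc _ ≤ Module.finrank ℝ (Submodule.span ℝ (Set.range y)) := Submodule.finrank_mono hle
    _ ≤ Fintype.card (Fin k) := finrank_range_le_card y
    _ < d := by simpa using hkd

end Separated

/-! ### Successive minima and a basis adapted to them -/

/-- A flag `W 0 ≤ W 1 ≤ ⋯ ≤ W n` whose `k`-th step is spanned by a shortest vector `v k` of `L`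
outside `W k`, and which ends when it contains all vectors of `L` of norm at most `1`. -/
structure IsMinimalFlag {E : Type*} [NormedAddCommGroup E] [NormedSpace ℝ E] (L : AddSubgroup E)
    (n : ℕ) (v : ℕ → E) (W : ℕ → Submodule ℝ E) : Prop where
  zero : W 0 = ⊥
  succ : ∀ k, W (k + 1) = W k ⊔ Submodule.span ℝ {v k}
  mem : ∀ k < n, v k ∈ L
  norm_le : ∀ k < n, ‖v k‖ ≤ 1
  notMem : ∀ k < n, v k ∉ W k
  norm_le_of_notMem : ∀ k < n, ∀ x ∈ L, x ∉ W k → ‖v k‖ ≤ ‖x‖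
  mem_last : ∀ x ∈ L, ‖x‖ ≤ 1 → x ∈ W n

section Flag

variable {E : Type*} [NormedAddCommGroup E] [NormedSpace ℝ E] {L : AddSubgroup E}

theorem exists_isMinimalFlag {d : ℕ} (hfin : {x | x ∈ L ∧ ‖x‖ ≤ 1}.Finite)
    (hrank : Module.finrank ℝ (Submodule.span ℝ {x | x ∈ L ∧ ‖x‖ ≤ 1}) < d) :
    ∃ n < d, ∃ v W, IsMinimalFlag L n v W := by
  classical
  have hpick : ∀ U : Submodule ℝ E, ∃ a : E, (∃ x ∈ L, ‖x‖ ≤ 1 ∧ x ∉ U) →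
      (a ∈ L ∧ ‖a‖ ≤ 1 ∧ a ∉ U ∧ ∀ x ∈ L, x ∉ U → ‖a‖ ≤ ‖x‖) := by
    intro U
    by_cases h : ∃ x ∈ L, ‖x‖ ≤ 1 ∧ x ∉ U
    · obtain ⟨x, hx, hx1, hxU⟩ := h
      obtain ⟨a, ⟨⟨haL, ha1⟩, haU⟩, hmin⟩ := Set.exists_min_image
        ({x | x ∈ L ∧ ‖x‖ ≤ 1} \ (U : Set E)) norm hfin.sdiff ⟨x, ⟨hx, hx1⟩, hxU⟩
      refine ⟨a, fun _ => ⟨haL, ha1, haU, fun b hb hbU => ?_⟩⟩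
      rcases le_total ‖b‖ 1 with hb1 | hb1
      · exact hmin b ⟨⟨hb, hb1⟩, hbU⟩
      · exact ha1.trans hb1
    · exact ⟨0, fun h' => absurd h' h⟩
  choose pick hpick using hpick
  obtain ⟨W, hzero, hsucc⟩ : ∃ W : ℕ → Submodule ℝ E, W 0 = ⊥ ∧
      ∀ k, W (k + 1) = W k ⊔ Submodule.span ℝ {pick (W k)} :=
    ⟨fun k => Nat.rec ⊥ (fun _ U => U ⊔ Submodule.span ℝ {pick U}) k, rfl, fun _ => rfl⟩
  have : FiniteDimensional ℝ (Submodule.span ℝ {x | x ∈ L ∧ ‖x‖ ≤ 1}) :=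
    FiniteDimensional.span_of_finite ℝ hfin
  have hgrow : ∀ m, (∀ k < m, ∃ x ∈ L, ‖x‖ ≤ 1 ∧ x ∉ W k) →
      W m ≤ Submodule.span ℝ {x | x ∈ L ∧ ‖x‖ ≤ 1} ∧ m ≤ Module.finrank ℝ (W m) := by
    intro m
    induction m with
    | zero => exact fun _ => ⟨hzero ▸ bot_le, Nat.zero_le _⟩
    | succ m ih =>
      intro h
      obtain ⟨h1, h2⟩ := ih fun k hk => h k (by omega)
      obtain ⟨haL, ha1, haU, -⟩ := hpick (W m) (h m (by omega))
      have hle : W (m + 1) ≤ Submodule.span ℝ {x | x ∈ L ∧ ‖x‖ ≤ 1} := by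
        rw [hsucc]
        refine sup_le h1 ((Submodule.span_singleton_le_iff_mem _ _).mpr ?_)
        exact Submodule.subset_span ⟨haL, ha1⟩
      have : FiniteDimensional ℝ (W (m + 1)) := Submodule.finiteDimensional_of_le hle
      have hlt : W m < W (m + 1) := by
        refine lt_of_le_of_ne (by rw [hsucc]; exact le_sup_left) fun h => haU (h.ge ?_)
        have hmem := Submodule.mem_span_singleton_self (R := ℝ) (pick (W m))
        exact hsucc m ▸ Submodule.mem_sup_right hmem
      exact ⟨hle, by have := Submodule.finrank_lt_finrank_of_lt hlt; omega⟩
  have hex : ∃ n, ∀ x ∈ L, ‖x‖ ≤ 1 → x ∈ W n := by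
    by_contra! hcon
    obtain ⟨h1, h2⟩ := hgrow d fun k _ => hcon k
    have := Submodule.finrank_mono h1
    omega
  have hlt : ∀ k < Nat.find hex, ∃ x ∈ L, ‖x‖ ≤ 1 ∧ x ∉ W k := by
    intro k hk
    have := Nat.find_min hex hk
    push Not at this
    exact this
  refine ⟨Nat.find hex, ?_, fun k => pick (W k), W, hzero, hsucc,
    fun k hk => (hpick _ (hlt k hk)).1, fun k hk => (hpick _ (hlt k hk)).2.1,
    fun k hk => (hpick _ (hlt k hk)).2.2.1, fun k hk => (hpick _ (hlt k hk)).2.2.2,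
    Nat.find_spec hex⟩
  obtain ⟨h1, h2⟩ := hgrow _ hlt
  have := Submodule.finrank_mono h1
  omega

namespace IsMinimalFlag

variable {n : ℕ} {v : ℕ → E} {W : ℕ → Submodule ℝ E}

theorem monotone (h : IsMinimalFlag L n v W) : Monotone W :=
  monotone_nat_of_le_succ fun k => by rw [h.succ]; exact le_sup_left

theorem mem_of_lt (h : IsMinimalFlag L n v W) {j k : ℕ} (hjk : j < k) : v j ∈ W k :=
  h.monotone hjk (by
    rw [h.succ]; exact Submodule.mem_sup_right (Submodule.mem_span_singleton_self _))

theorem norm_pos (h : IsMinimalFlag L n v W) {k : ℕ} (hk : k < n) : 0 < ‖v k‖ := by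
  rw [norm_pos_iff]
  intro h0
  exact h.notMem k hk (h0 ▸ (W k).zero_mem)

theorem norm_mono (h : IsMinimalFlag L n v W) {j k : ℕ} (hjk : j ≤ k) (hk : k < n) :
    ‖v j‖ ≤ ‖v k‖ :=
  h.norm_le_of_notMem j (by omega) _ (h.mem k hk) fun hmem => h.notMem k hk (h.monotone hjk hmem)

theorem exists_sub_smul_mem (h : IsMinimalFlag L n v W) {k : ℕ} {x : E} (hx : x ∈ W (k + 1)) :
    ∃ t : ℝ, x - t • v k ∈ W k := by
  rw [h.succ, Submodule.mem_sup] at hx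
  obtain ⟨y, hy, z, hz, rfl⟩ := hx
  obtain ⟨t, rfl⟩ := Submodule.mem_span_singleton.mp hz
  exact ⟨t, by simpa using hy⟩

theorem eq_zero_of_sum_smul_eq_zero (h : IsMinimalFlag L n v W) {t : ℕ → ℝ} :
    ∀ m ≤ n, ∑ i ∈ Finset.range m, t i • v i = 0 → ∀ i < m, t i = 0 := by
  intro m
  induction m with
  | zero => simp
  | succ m ih =>
    intro hm hsum i hi
    rw [Finset.sum_range_succ] at hsum
    have hW : t m • v m ∈ W m := by
      rw [← neg_eq_of_add_eq_zero_right hsum]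
      exact (W m).neg_mem <| (W m).sum_mem fun j hj =>
        (W m).smul_mem _ (h.mem_of_lt (Finset.mem_range.mp hj))
    have hm0 : t m = 0 := by
      by_contra hne
      exact h.notMem m (by omega) (((W m).smul_mem_iff hne).mp hW)
    rcases Nat.lt_succ_iff_lt_or_eq.mp hi with hi | rfl
    · exact ih (by omega) (by simpa [hm0] using hsum) i hi
    · exact hm0

/-- Round down the coefficients of `v (k-1), …, v 0` in turn; each rounding costs at most `‖v i‖ ≤
1`. -/
theorem exists_mem_norm_sub_le (h : IsMinimalFlag L n v W) :
    ∀ k ≤ n, ∀ x ∈ W k, ∃ z ∈ L, z ∈ W k ∧ ‖x - z‖ ≤ k := by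
  intro k
  induction k with
  | zero =>
    intro _ x hx
    rw [h.zero, Submodule.mem_bot] at hx
    exact ⟨0, L.zero_mem, (W 0).zero_mem, by simp [hx]⟩
  | succ k ih =>
    intro hk x hx
    obtain ⟨t, ht⟩ := h.exists_sub_smul_mem hx
    obtain ⟨z, hzL, hzW, hz⟩ := ih (by omega) _ ht
    refine ⟨z + ⌊t⌋ • v k, L.add_mem hzL (L.zsmul_mem (h.mem k hk) _),
      (W _).add_mem (h.monotone k.le_succ hzW) (zsmul_mem (h.mem_of_lt k.lt_succ_self) _), ?_⟩
    have heq : x - (z + ⌊t⌋ • v k) = (x - t • v k - z) + Int.fract t • v k := by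
      rw [← Int.cast_smul_eq_zsmul ℝ, Int.fract, sub_smul]; abel
    rw [heq, Nat.cast_succ]
    refine (norm_add_le _ _).trans (add_le_add hz ?_)
    rw [norm_smul, Real.norm_of_nonneg (Int.fract_nonneg t)]
    exact mul_le_one₀ (Int.fract_lt_one t).le (norm_nonneg _) (h.norm_le k hk)

/-- The quotient of `L ∩ W (k+1)` by `W k` embeds in `ℝ` through a functional `f`, and its generator
is the least positive value. The minimum is sought only in the finite ball of radius `n`; this
suffices because a remainder with `0 ≤ f y < f b ≤ 1` can be moved modulo `L ∩ W k` into that ball,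
at norm at most `k + 1 ≤ n`. -/
theorem exists_generator (h : IsMinimalFlag L n v W)
    (hfin : {x | x ∈ L ∧ ‖x‖ ≤ n}.Finite) {k : ℕ} (hk : k < n) :
    ∃ b ∈ L, b ∈ W (k + 1) ∧ b ∉ W k ∧ ∀ x ∈ L, x ∈ W (k + 1) → ∃ m : ℤ, x - m • b ∈ W k := by
  obtain ⟨f, hf0, hfker⟩ := Submodule.exists_le_ker_of_notMem (h.notMem k hk)
  wlog hf1 : f (v k) = 1 generalizing f
  · refine this ((f (v k))⁻¹ • f) (by simp [hf0]) (fun x hx => ?_) (by simp [hf0])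
    have : f x = 0 := hfker hx
    simp [this]
  have hker : ∀ x ∈ W k, f x = 0 := fun x hx => hfker hx
  have hcoef : ∀ x ∈ W (k + 1), x - f x • v k ∈ W k := by
    intro x hx
    obtain ⟨t, ht⟩ := h.exists_sub_smul_mem hx
    have := hker _ ht
    rw [map_sub, map_smul, hf1, smul_eq_mul, mul_one, sub_eq_zero] at this
    rwa [this]
  have hkn : (k : ℝ) + 1 ≤ n := by exact_mod_cast hk
  have hvk : ‖v k‖ ≤ n := (h.norm_le k hk).trans (by have := k.cast_nonneg (α := ℝ); linarith)
  obtain ⟨b, ⟨hbL, hbn, hbW, hb0⟩, hbmin⟩ := Set.exists_min_image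
    {x | x ∈ L ∧ ‖x‖ ≤ n ∧ x ∈ W (k + 1) ∧ 0 < f x} f
    (hfin.subset fun x hx => ⟨hx.1, hx.2.1⟩)
    ⟨v k, h.mem k hk, hvk, h.mem_of_lt k.lt_succ_self, by simp [hf1]⟩
  have hb1 : f b ≤ 1 := hf1 ▸ hbmin (v k)
    ⟨h.mem k hk, hvk, h.mem_of_lt k.lt_succ_self, by simp [hf1]⟩
  refine ⟨b, hbL, hbW, fun hb => hb0.ne' (hker b hb), fun x hxL hxW => ⟨⌊f x / f b⌋, ?_⟩⟩
  set y := x - ⌊f x / f b⌋ • b with hy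
  have hyL : y ∈ L := L.sub_mem hxL (L.zsmul_mem hbL _)
  have hyW : y ∈ W (k + 1) := (W _).sub_mem hxW (zsmul_mem hbW _)
  have hfy : f y = Int.fract (f x / f b) * f b := by
    rw [hy, map_sub, map_zsmul, zsmul_eq_mul, Int.fract, sub_mul, div_mul_cancel₀ _ hb0.ne']
  have hfy0 : 0 ≤ f y := hfy ▸ mul_nonneg (Int.fract_nonneg _) hb0.le
  have hfyb : f y < f b := by
    rw [hfy]; exact mul_lt_of_lt_one_left hb0 (Int.fract_lt_one _)
  obtain ⟨z, hzL, hzW, hz⟩ := h.exists_mem_norm_sub_le k hk.le _ (hcoef y hyW)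
  have hfyz : f (y - z) = f y := by rw [map_sub, hker z hzW, sub_zero]
  have hnorm : ‖y - z‖ ≤ n := by
    have heq : y - z = (y - f y • v k - z) + f y • v k := by abel
    have h2 : ‖f y • v k‖ ≤ 1 := by
      rw [norm_smul, Real.norm_of_nonneg hfy0]
      exact mul_le_one₀ (hfyb.le.trans hb1) (norm_nonneg _) (h.norm_le k hk)
    rw [heq]
    exact (norm_add_le _ _).trans (by linarith)
  have hzero : f y = 0 := by
    by_contra hne
    have := hbmin (y - z) ⟨L.sub_mem hyL hzL, hnorm,
      (W _).sub_mem hyW (h.monotone k.le_succ hzW), hfyz ▸ lt_of_le_of_ne hfy0 (Ne.symm hne)⟩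
    linarith
  simpa [hzero] using hcoef y hyW

/-- The short vectors of `L` are distinguished by their coordinates, in a basis adapted to the
flag, modulo powers of two exceeding `2 / ‖v k‖`. -/
theorem ncard_le_prod (h : IsMinimalFlag L n v W) (hfin : {x | x ∈ L ∧ ‖x‖ ≤ n}.Finite)
    {a : ℕ → ℕ} (ha : ∀ k < n, 2 < 2 ^ a k * ‖v k‖) (hanti : ∀ j k, j ≤ k → k < n → a k ≤ a j) :
    {x | x ∈ L ∧ ‖x‖ ≤ 1}.ncard ≤ ∏ k ∈ Finset.range n, 2 ^ a k := by
  classical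
  have hgen : ∀ k, ∃ b, k < n → b ∈ L ∧ b ∈ W (k + 1) ∧ b ∉ W k ∧
      ∀ x ∈ L, x ∈ W (k + 1) → ∃ m : ℤ, x - m • b ∈ W k := fun k => by
    by_cases hk : k < n
    · obtain ⟨b, hb⟩ := h.exists_generator hfin hk
      exact ⟨b, fun _ => hb⟩
    · exact ⟨0, fun h' => absurd h' hk⟩
  choose b hb using hgen
  have hcoord : ∀ m ≤ n, ∀ x ∈ L, x ∈ W m → ∃ c : ℕ → ℤ, x = ∑ i ∈ Finset.range m, c i • b i := by
    intro m
    induction m with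
    | zero =>
      intro _ x _ hx
      rw [h.zero, Submodule.mem_bot] at hx
      exact ⟨0, by simp [hx]⟩
    | succ m ih =>
      intro hm x hxL hxW
      obtain ⟨hbL, hbW, -, hgen⟩ := hb m hm
      obtain ⟨q, hq⟩ := hgen x hxL hxW
      obtain ⟨c, hc⟩ := ih (by omega) _ (L.sub_mem hxL (L.zsmul_mem hbL q)) hq
      refine ⟨Function.update c m q, ?_⟩
      rw [Finset.sum_range_succ, Function.update_self, eq_add_of_sub_eq hc]
      congr 1
      refine Finset.sum_congr rfl fun i hi => ?_
      rw [Function.update_of_ne (Finset.mem_range.mp hi).ne]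
  have hvanish : ∀ m ≤ n, ∀ e : ℕ → ℤ,
      ‖∑ i ∈ Finset.range m, ((2 ^ a i : ℕ) * e i) • b i‖ ≤ 2 →
      ∑ i ∈ Finset.range m, ((2 ^ a i : ℕ) * e i) • b i = 0 := by
    intro m
    induction m with
    | zero => simp
    | succ m ih =>
      intro hm e hle
      obtain ⟨hbL, hbW, hbnot, -⟩ := hb m hm
      -- The exponents decrease, so `2 ^ a m` divides every coefficient. Dividing by it leaves `w ∈
      -- L`; if `e m ≠ 0` then `w ∉ W m`, so `‖w‖ ≥ ‖v m‖` and the sum has norm above `2`.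
      have hem : e m = 0 := by
        by_contra hne
        set w := ∑ i ∈ Finset.range (m + 1), (2 ^ (a i - a m) * e i) • b i with hw
        have hwL : w ∈ L := L.sum_mem fun i hi =>
          L.zsmul_mem (hb i (by have := Finset.mem_range.mp hi; omega)).1 _
        have hscale : ∑ i ∈ Finset.range (m + 1), ((2 ^ a i : ℕ) * e i) • b i
            = (2 ^ a m : ℝ) • w := by
          rw [hw, Finset.smul_sum]
          refine Finset.sum_congr rfl fun i hi => ?_
          have him := hanti i m (by have := Finset.mem_range.mp hi; omega) hm
          rw [← Int.cast_smul_eq_zsmul ℝ, ← Int.cast_smul_eq_zsmul ℝ, smul_smul]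
          congr 1
          push_cast
          rw [← mul_assoc, ← pow_add, Nat.add_sub_cancel' him]
        rw [hscale, norm_smul, Real.norm_of_nonneg (by positivity)] at hle
        have hwW : w ∉ W m := by
          intro hwW
          rw [hw, Finset.sum_range_succ, Submodule.add_mem_iff_right _ ((W m).sum_mem fun i hi =>
            zsmul_mem (h.monotone (Finset.mem_range.mp hi) (hb i (by
              have := Finset.mem_range.mp hi; omega)).2.1) _)] at hwW
          rw [Nat.sub_self, pow_zero, one_mul, ← Int.cast_smul_eq_zsmul ℝ,
            (W m).smul_mem_iff (by exact_mod_cast hne)] at hwW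
          exact hbnot hwW
        have h1 := h.norm_le_of_notMem m hm w hwL hwW
        have h2 := mul_le_mul_of_nonneg_left h1 (by positivity : (0 : ℝ) ≤ 2 ^ a m)
        linarith [ha m hm]
      rw [Finset.sum_range_succ, hem, mul_zero, zero_smul, add_zero] at hle ⊢
      exact ih (by omega) e hle
  have hc : ∀ x, ∃ c : ℕ → ℤ, x ∈ L ∧ ‖x‖ ≤ 1 → x = ∑ i ∈ Finset.range n, c i • b i := fun x => by
    by_cases hx : x ∈ L ∧ ‖x‖ ≤ 1
    · obtain ⟨c, hc⟩ := hcoord n le_rfl x hx.1 (h.mem_last x hx.1 hx.2)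
      exact ⟨c, fun _ => hc⟩
    · exact ⟨0, fun h' => absurd h' hx⟩
  choose c hc using hc
  have hcard : (Set.univ : Set ((k : Fin n) → ZMod (2 ^ a k))).ncard
      = ∏ k ∈ Finset.range n, 2 ^ a k := by
    rw [Set.ncard_univ, Nat.card_pi, Finset.prod_range]
    simp
  rw [← hcard]
  have : Finite ((k : Fin n) → ZMod (2 ^ a k)) := Pi.finite
  refine Set.ncard_le_ncard_of_injOn (fun x k => (c x k : ZMod (2 ^ a k)))
    (fun _ _ => Set.mem_univ _) ?_ Set.finite_univ
  intro x hx y hy hxy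
  have hdvd : ∀ i, ∃ e : ℤ, i < n → c x i - c y i = (2 ^ a i : ℕ) * e := fun i => by
    by_cases hi : i < n
    · obtain ⟨e, he⟩ := (ZMod.intCast_eq_intCast_iff_dvd_sub _ _ _).mp (congrFun hxy ⟨i, hi⟩).symm
      exact ⟨e, fun _ => he⟩
    · exact ⟨0, fun h' => absurd h' hi⟩
  choose e he using hdvd
  have hsub : x - y = ∑ i ∈ Finset.range n, ((2 ^ a i : ℕ) * e i) • b i := by
    conv_lhs => rw [hc x hx, hc y hy]
    rw [← Finset.sum_sub_distrib]
    refine Finset.sum_congr rfl fun i hi => ?_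
    rw [← sub_smul, he i (Finset.mem_range.mp hi)]
  have h0 := hvanish n le_rfl e (by
    rw [← hsub]; exact (norm_sub_le _ _).trans (by linarith [hx.2, hy.2]))
  rwa [← hsub, sub_eq_zero] at h0

end IsMinimalFlag

end Flag

/-! ### Progressions in discrete groups with small growth -/

section Progression

variable {E : Type*} [NormedAddCommGroup E] [NormedSpace ℝ E] {L : AddSubgroup E}

theorem four_mul_pow_le_pow {n d : ℕ} (hnd : n < d) : (4 * n) ^ n ≤ d ^ (3 * d) := by
  rcases Nat.eq_zero_or_pos n with rfl | hn
  · rw [pow_zero]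
    exact Nat.one_le_pow _ _ hnd
  · have h4 : 4 * n ≤ d ^ 3 := by nlinarith [Nat.mul_le_mul (by omega : 2 ≤ d) (by omega : 2 ≤ d)]
    calc (4 * n) ^ n ≤ (d ^ 3) ^ n := Nat.pow_le_pow_left h4 n
      _ = d ^ (3 * n) := (pow_mul _ _ _).symm
      _ ≤ d ^ (3 * d) := Nat.pow_le_pow_right (by omega) (by omega)

theorem IsMinimalFlag.exists_lengths {n : ℕ} {v : ℕ → E} {W : ℕ → Submodule ℝ E}
    (h : IsMinimalFlag L n v W) (hfin : {x | x ∈ L ∧ ‖x‖ ≤ n}.Finite) :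
    ∃ N : ℕ → ℕ, (∀ k, 0 < N k) ∧ (∀ k < n, ((N k : ℝ) - 1) * ‖v k‖ ≤ 1 / n) ∧
      {x | x ∈ L ∧ ‖x‖ ≤ 1}.ncard ≤ (4 * n) ^ n * ∏ k ∈ Finset.range n, N k := by
  -- Here `2 / ‖v k‖ < 2 ^ a k ≤ 4 / ‖v k‖`, while `N k > 1 / (n * ‖v k‖)`; the ratio is at most `4
  -- * n` per coordinate.
  set a : ℕ → ℕ := fun k => Nat.log 2 ⌊2 / ‖v k‖⌋₊ + 1 with ha
  set N : ℕ → ℕ := fun k => ⌊1 / (n * ‖v k‖)⌋₊ + 1 with hN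
  refine ⟨N, fun k => Nat.succ_pos _, fun k hk => ?_, ?_⟩
  · have hv := h.norm_pos hk
    have h1 : (N k : ℝ) - 1 ≤ 1 / (n * ‖v k‖) := by
      simp only [hN]; push_cast
      linarith [Nat.floor_le (by positivity : 0 ≤ 1 / (n * ‖v k‖))]
    calc ((N k : ℝ) - 1) * ‖v k‖ ≤ 1 / (n * ‖v k‖) * ‖v k‖ := by gcongr
      _ = 1 / n := by field_simp
  · have h1 : {x | x ∈ L ∧ ‖x‖ ≤ 1}.ncard ≤ ∏ k ∈ Finset.range n, 2 ^ a k := by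
      refine h.ncard_le_prod hfin (fun k hk => ?_) fun j k hjk hk => ?_
      · have hv := h.norm_pos hk
        have hlt : ⌊2 / ‖v k‖⌋₊ < 2 ^ a k := Nat.lt_pow_succ_log_self (by norm_num) _
        have hlt' : 2 / ‖v k‖ < 2 ^ a k := by
          have := (Nat.floor_lt (by positivity)).mp hlt
          exact_mod_cast this
        exact (div_lt_iff₀ hv).mp hlt'
      · have hv := h.norm_pos (hjk.trans_lt hk)
        have := h.norm_mono hjk hk
        simp only [ha]
        gcongr
    refine h1.trans ?_
    rw [← Finset.card_range n, ← Finset.prod_const, Finset.card_range, ← Finset.prod_mul_distrib]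
    refine Finset.prod_le_prod' fun k hk => ?_
    have hk := Finset.mem_range.mp hk
    have hv := h.norm_pos hk
    have hn : (0 : ℝ) < n := by exact_mod_cast (by omega : 0 < n)
    have hfloor : ⌊2 / ‖v k‖⌋₊ ≠ 0 := by
      rw [← Nat.pos_iff_ne_zero, Nat.floor_pos, le_div_iff₀ hv]
      linarith [h.norm_le k hk]
    have h2 : ((2 ^ Nat.log 2 ⌊2 / ‖v k‖⌋₊ : ℕ) : ℝ) ≤ 2 / ‖v k‖ :=
      (Nat.cast_le.mpr (Nat.pow_log_le_self 2 hfloor)).trans (Nat.floor_le (by positivity))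
    have h3 : 1 / (n * ‖v k‖) < N k := by
      simp only [hN]; push_cast; exact Nat.lt_floor_add_one _
    have h4 : ((2 ^ a k : ℕ) : ℝ) ≤ ((4 * n * N k : ℕ) : ℝ) := by
      calc ((2 ^ a k : ℕ) : ℝ) = 2 * ((2 ^ Nat.log 2 ⌊2 / ‖v k‖⌋₊ : ℕ) : ℝ) := by
            simp only [ha]; push_cast; ring
        _ ≤ 2 * (2 / ‖v k‖) := by gcongr
        _ = 4 * n * (1 / (n * ‖v k‖)) := by field_simp; norm_num
        _ ≤ 4 * n * N k := by gcongr
        _ = _ := by push_cast; ring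
    exact_mod_cast h4

/-- A group `L` of vectors with fewer than `2 ^ d` times as many elements of norm at most `3 d + 1`
as of norm at most `1` has a large `d`-dimensional proper progression inside the unit ball. -/
theorem exists_progression_of_ncard_lt {d : ℕ}
    (hfin : {x | x ∈ L ∧ ‖x‖ ≤ 3 * (d : ℝ) + 1}.Finite)
    (hlt : {x | x ∈ L ∧ ‖x‖ ≤ 3 * (d : ℝ) + 1}.ncard < 2 ^ d * {x | x ∈ L ∧ ‖x‖ ≤ 1}.ncard) :
    ∃ (v : Fin d → E) (N : Fin d → ℕ), (∀ i, v i ∈ L) ∧ (∀ i, 0 < N i) ∧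
      (∀ l : (i : Fin d) → Fin (N i), ‖∑ i, (l i : ℕ) • v i‖ ≤ 1) ∧
      (Function.Injective fun l : (i : Fin d) → Fin (N i) => ∑ i, (l i : ℕ) • v i) ∧
      {x | x ∈ L ∧ ‖x‖ ≤ 1}.ncard ≤ d ^ (3 * d) * ∏ i, N i := by
  obtain ⟨n, hnd, v, W, h⟩ := exists_isMinimalFlag
    (hfin.subset fun x hx => ⟨hx.1, hx.2.trans (by linarith [d.cast_nonneg (α := ℝ)])⟩)
    (finrank_span_lt_of_ncard_lt hfin hlt)
  have hnd' : (n : ℝ) ≤ d := by exact_mod_cast hnd.le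
  obtain ⟨N, hN0, hN, hcard⟩ := h.exists_lengths
    (hfin.subset fun x hx => ⟨hx.1, hx.2.trans (by linarith [d.cast_nonneg (α := ℝ)])⟩)
  -- Zero steps of length `1` pad the dimension from `n` to `d` without affecting properness.
  set v' : Fin d → E := fun i => if (i : ℕ) < n then v i else 0 with hv'
  set N' : Fin d → ℕ := fun i => if (i : ℕ) < n then N i else 1 with hN'
  have hsum : ∀ c : ℕ → ℝ, ∑ i : Fin d, c i • v' i = ∑ i ∈ Finset.range n, c i • v i := by
    intro c
    simp only [hv', smul_ite, smul_zero]
    rw [← Finset.sum_range (fun i => if i < n then c i • v i else 0), ← Finset.sum_filter]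
    congr 1
    ext i; simp only [Finset.mem_filter, Finset.mem_range]; omega
  have hext : ∀ l : (i : Fin d) → Fin (N' i), ∃ c : ℕ → ℕ, ∀ i, (l i : ℕ) = c i := fun l =>
    ⟨fun i => if hi : i < d then l ⟨i, hi⟩ else 0, fun i => by simp⟩
  have hcast : ∀ l : (i : Fin d) → Fin (N' i), ∀ c : ℕ → ℕ, (∀ i, (l i : ℕ) = c i) →
      ∑ i, (l i : ℕ) • v' i = ∑ i ∈ Finset.range n, (c i : ℝ) • v i := by
    intro l c hc
    rw [← hsum]
    exact Finset.sum_congr rfl fun i _ => by rw [Nat.cast_smul_eq_nsmul, hc]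
  refine ⟨v', N', fun i => ?_, fun i => ?_, fun l => ?_, fun l l' hll => ?_, ?_⟩
  · simp only [hv']
    split_ifs with hi
    · exact h.mem _ hi
    · exact L.zero_mem
  · simp only [hN']
    split_ifs
    · exact hN0 _
    · exact one_pos
  · obtain ⟨c, hc⟩ := hext l
    rw [hcast l c hc]
    refine (norm_sum_le _ _).trans ?_
    have : ∀ i ∈ Finset.range n, ‖(c i : ℝ) • v i‖ ≤ 1 / n := by
      intro i hi
      have hi := Finset.mem_range.mp hi
      have hlt : c i < N i := by
        have h1 := (l ⟨i, hi.trans hnd⟩).isLt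
        rw [hc] at h1
        simpa [hN', hi] using h1
      have hle : (c i : ℝ) ≤ N i - 1 := by
        have : (c i : ℝ) + 1 ≤ N i := by exact_mod_cast hlt
        linarith
      rw [norm_smul, Real.norm_natCast]
      exact (mul_le_mul_of_nonneg_right hle (norm_nonneg _)).trans (hN i hi)
    refine (Finset.sum_le_sum this).trans ?_
    rw [Finset.sum_const, Finset.card_range, nsmul_eq_mul]
    rw [mul_one_div]
    exact div_self_le_one _
  · obtain ⟨c, hc⟩ := hext l
    obtain ⟨c', hc'⟩ := hext l'
    dsimp only at hll
    rw [hcast l c hc, hcast l' c' hc', ← sub_eq_zero, ← Finset.sum_sub_distrib] at hll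
    simp only [← sub_smul] at hll
    have h0 := h.eq_zero_of_sum_smul_eq_zero n le_rfl hll
    funext i
    by_cases hi : (i : ℕ) < n
    · refine Fin.ext ?_
      rw [hc, hc']
      exact_mod_cast sub_eq_zero.mp (h0 i hi)
    · have h1 : N' i = 1 := by simp [hN', hi]
      refine Fin.ext ?_
      have := (l i).isLt
      have := (l' i).isLt
      omega
  · have hprod : ∏ i, N' i = ∏ k ∈ Finset.range n, N k := by
      simp only [hN']
      rw [← Finset.prod_range (fun i => if i < n then N i else 1), ← Finset.prod_filter]
      congr 1
      ext i; simp only [Finset.mem_filter, Finset.mem_range]; omega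
    rw [hprod]
    exact hcard.trans (Nat.mul_le_mul_right _ (four_mul_pow_le_pow hnd))

end Progression

/-! ### Distances on the circle -/

theorem norm_one_sub_circle_exp (t : ℝ) :
    ‖(1 : ℂ) - (Circle.exp t : ℂ)‖ = 2 * |Real.sin (t / 2)| := by
  rw [norm_sub_rev, Circle.coe_exp, mul_comm, Complex.norm_exp_I_mul_ofReal_sub_one, norm_mul,
    Real.norm_ofNat, Real.norm_eq_abs]

theorem norm_one_sub_pow_le_of_circle (z : Circle) (n : ℕ) :
    ‖(1 : ℂ) - ((z ^ n : Circle) : ℂ)‖ ≤ n * ‖(1 : ℂ) - (z : ℂ)‖ := by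
  induction n with
  | zero => simp
  | succ n ih =>
    have heq : (1 : ℂ) - ((z ^ (n + 1) : Circle) : ℂ)
        = (1 - ((z ^ n : Circle) : ℂ)) + ((z ^ n : Circle) : ℂ) * (1 - (z : ℂ)) := by
      push_cast; ring
    rw [heq]
    refine (norm_add_le _ _).trans ?_
    rw [norm_mul, Circle.norm_coe, one_mul, Nat.cast_succ, add_one_mul]
    exact add_le_add_left ih _

theorem norm_one_sub_circle_exp_le {s t : ℝ} (hs0 : 0 ≤ s) (hs2 : s ≤ 2)
    (ht : |t| ≤ 2 * Real.arcsin (s / 2)) : ‖(1 : ℂ) - (Circle.exp t : ℂ)‖ ≤ s := by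
  have hle : |t / 2| ≤ Real.arcsin (s / 2) := by
    rw [abs_div, abs_two]; linarith
  have hpi := Real.arcsin_le_pi_div_two (s / 2)
  rw [norm_one_sub_circle_exp,
    Real.abs_sin_eq_sin_abs_of_abs_le_pi (by linarith [Real.pi_pos])]
  have := (Real.le_arcsin_iff_sin_le
    ⟨by linarith [abs_nonneg (t / 2), Real.pi_pos], hle.trans hpi⟩
    ⟨by linarith, by linarith⟩).mp hle
  linarith

theorem abs_arg_le_of_norm_one_sub_le {s : ℝ} {z : Circle} (hs2 : s ≤ 2)
    (hz : ‖(1 : ℂ) - (z : ℂ)‖ ≤ s) : |Complex.arg z| ≤ 2 * Real.arcsin (s / 2) := by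
  have hs0 : 0 ≤ s := (norm_nonneg _).trans hz
  have hpi : |Complex.arg z / 2| ≤ Real.pi / 2 := by
    rw [abs_div, abs_two]; linarith [Complex.abs_arg_le_pi z]
  rw [← Circle.exp_arg z, norm_one_sub_circle_exp,
    Real.abs_sin_eq_sin_abs_of_abs_le_pi (by linarith [Real.pi_pos])] at hz
  have := (Real.le_arcsin_iff_sin_le
    ⟨by linarith [abs_nonneg (Complex.arg z / 2), Real.pi_pos], hpi⟩
    ⟨by linarith, by linarith⟩).mpr (by linarith : _ ≤ s / 2)
  rw [abs_div, abs_two] at this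
  linarith

/-! ### The lattice of lifts of a Bohr set -/

namespace BohrSet

variable {G : Type*} [AddCommGroup G] (D : BohrSet G)

/-- The angle of the arc `{z : |1 - z| ≤ δ_γ}` on either side of `1`. -/
noncomputable def angle (γ : D.freq) : ℝ := 2 * Real.arcsin (D.width γ / 2)

/-- `θ` is a lift of `x`: the vector of arguments of the `γ x`, in units of the angles of `D`. -/
def IsLift (θ : D.freq → ℝ) (x : G) : Prop := ∀ γ, Circle.exp (D.angle γ * θ γ) = γ.1 x

/-- The group of all lifts of elements of `G`. -/
def lifts : AddSubgroup (D.freq → ℝ) where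
  carrier := {θ | ∃ x, D.IsLift θ x}
  zero_mem' := ⟨0, fun γ => by simp⟩
  add_mem' := by
    rintro θ η ⟨x, hx⟩ ⟨y, hy⟩
    exact ⟨x + y, fun γ => by
      rw [Pi.add_apply, mul_add, Circle.exp_add, hx γ, hy γ, AddChar.map_add_eq_mul]⟩
  neg_mem' := by
    rintro θ ⟨x, hx⟩
    exact ⟨-x, fun γ => by
      rw [Pi.neg_apply, mul_neg, Circle.exp_neg, hx γ, AddChar.map_neg_eq_inv]⟩

/-- The common kernel of the frequencies. -/
def kernel : AddSubgroup G where
  carrier := {x | ∀ γ : D.freq, γ.1 x = 1}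
  zero_mem' := fun γ => by simp
  add_mem' := fun hx hy γ => by rw [AddChar.map_add_eq_mul, hx γ, hy γ, one_mul]
  neg_mem' := fun hx γ => by rw [AddChar.map_neg_eq_inv, hx γ, inv_one]

variable {D}

theorem angle_pos (γ : D.freq) : 0 < D.angle γ :=
  mul_pos two_pos (Real.arcsin_pos.mpr (by linarith [D.width_pos γ]))

theorem angle_le (γ : D.freq) : D.angle γ ≤ Real.pi / 2 * D.width γ := by
  have h0 := D.width_pos γ
  have h2 := D.width_le_two γ
  have h := Real.mul_le_sin (Real.arcsin_nonneg.mpr (by linarith : 0 ≤ D.width γ / 2))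
    (Real.arcsin_le_pi_div_two _)
  rw [Real.sin_arcsin (by linarith) (by linarith), div_mul_eq_mul_div,
    div_le_iff₀ Real.pi_pos] at h
  unfold angle
  linarith

theorem IsLift.add_kernel {θ : D.freq → ℝ} {x h : G} (hx : D.IsLift θ x) (hh : h ∈ D.kernel) :
    D.IsLift θ (h + x) := fun γ => by
  rw [hx γ, AddChar.map_add_eq_mul, hh γ, one_mul]

theorem IsLift.sub_mem_kernel {θ : D.freq → ℝ} {x y : G} (hx : D.IsLift θ x)
    (hy : D.IsLift θ y) : x - y ∈ D.kernel := fun γ => by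
  rw [AddChar.map_sub_eq_div, ← hx γ, ← hy γ, div_self']

theorem IsLift.sum_nsmul {ι : Type*} {s : Finset ι} {θ : ι → D.freq → ℝ} {x : ι → G} {l : ι → ℕ}
    (h : ∀ i, D.IsLift (θ i) (x i)) : D.IsLift (∑ i ∈ s, l i • θ i) (∑ i ∈ s, l i • x i) := by
  classical
  induction s using Finset.induction_on with
  | empty => intro γ; simp
  | insert i s his ih =>
    intro γ
    rw [Finset.sum_insert his, Finset.sum_insert his, Pi.add_apply, mul_add, Circle.exp_add, ih γ,
      AddChar.map_add_eq_mul, AddChar.map_nsmul_eq_pow, ← h i γ, Pi.smul_apply, nsmul_eq_mul,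
      mul_left_comm, Circle.exp_natCast_mul]

variable [Fintype D.freq]

/-- Two short lifts of the same element are equal. -/
theorem IsLift.unique {R : ℝ} (hR : ∀ γ, R * D.angle γ < Real.pi) {θ η : D.freq → ℝ} {x : G}
    (hθ : D.IsLift θ x) (hη : D.IsLift η x) (hθR : ‖θ‖ ≤ R) (hηR : ‖η‖ ≤ R) : θ = η := by
  have hbound : ∀ ζ : D.freq → ℝ, ‖ζ‖ ≤ R → ∀ γ, |D.angle γ * ζ γ| < Real.pi := by
    intro ζ hζ γ
    rw [abs_mul, abs_of_pos (angle_pos γ), mul_comm]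
    exact (mul_le_mul_of_nonneg_right ((norm_le_pi_norm ζ γ).trans hζ)
      (angle_pos γ).le).trans_lt (hR γ)
  funext γ
  have h1 := abs_lt.mp (hbound θ hθR γ)
  have h2 := abs_lt.mp (hbound η hηR γ)
  have h : Complex.arg (Circle.exp (D.angle γ * θ γ))
      = Complex.arg (Circle.exp (D.angle γ * η γ)) := by
    rw [hθ γ, hη γ]
  rw [Circle.arg_exp h1.1 h1.2.le, Circle.arg_exp h2.1 h2.2.le] at h
  exact mul_left_cancel₀ (angle_pos γ).ne' h

/-- Cut each angle into `n` equal parts: each part lies in the arc of chord `D.width γ`, and chords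
are subadditive under multiplication on the circle. -/
theorem IsLift.norm_one_sub_le {n : ℕ} (hn : 0 < n) {θ : D.freq → ℝ} {x : G}
    (hθ : D.IsLift θ x) (hθn : ‖θ‖ ≤ n) (γ : D.freq) :
    ‖(1 : ℂ) - (γ.1 x : ℂ)‖ ≤ n * D.width γ := by
  have hn' : (0 : ℝ) < n := by exact_mod_cast hn
  have heq : D.angle γ * θ γ = n * (D.angle γ * θ γ / n) := by field_simp
  rw [← hθ γ, heq, Circle.exp_natCast_mul]
  refine (norm_one_sub_pow_le_of_circle _ n).trans ?_
  gcongr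
  refine norm_one_sub_circle_exp_le (D.width_pos γ).le (D.width_le_two γ) ?_
  rw [abs_div, abs_mul, abs_of_pos (angle_pos γ), Nat.abs_cast, div_le_iff₀ hn']
  exact mul_le_mul_of_nonneg_left ((norm_le_pi_norm θ γ).trans hθn) (angle_pos γ).le

theorem exists_isLift_of_mem_carrier {x : G} (hx : x ∈ D.carrier) :
    ∃ θ, D.IsLift θ x ∧ ‖θ‖ ≤ 1 := by
  refine ⟨fun γ => Complex.arg (γ.1 x) / D.angle γ, fun γ => ?_,
    (pi_norm_le_iff_of_nonneg zero_le_one).mpr fun γ => ?_⟩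
  · rw [mul_div_cancel₀ _ (angle_pos γ).ne', Circle.exp_arg]
  · rw [Real.norm_eq_abs, abs_div, abs_of_pos (angle_pos γ), div_le_one (angle_pos γ)]
    exact abs_arg_le_of_norm_one_sub_le (D.width_le_two γ) (hx γ)

variable [Finite G]

theorem finite_lifts {R : ℝ} (hR : ∀ γ, R * D.angle γ < Real.pi) :
    {θ | θ ∈ D.lifts ∧ ‖θ‖ ≤ R}.Finite := by
  classical
  choose! g hg using fun θ (h : θ ∈ D.lifts) => h
  refine Set.Finite.of_finite_image (Set.toFinite (g '' _)) fun θ hθ η hη h => ?_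
  exact (hg θ hθ.1).unique hR (h ▸ hg η hη.1) hθ.2 hη.2

/-- Choose an element `g θ` under each lift. The map `(h, θ) ↦ h + g θ` is injective on `K` times
the ball, since `θ` is a lift of `h + g θ` and short lifts are unique. -/
theorem card_kernel_mul_ncard_lifts_le {R : ℝ} (hR : ∀ γ, R * D.angle γ < Real.pi) {S : Set G}
    (hS : ∀ θ x, ‖θ‖ ≤ R → D.IsLift θ x → x ∈ S) :
    Nat.card D.kernel * {θ | θ ∈ D.lifts ∧ ‖θ‖ ≤ R}.ncard ≤ S.ncard := by
  choose! g hg using fun θ (h : θ ∈ D.lifts) => h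
  have hcard : Nat.card D.kernel = (D.kernel : Set G).ncard := rfl
  rw [hcard, ← Set.ncard_prod]
  refine Set.ncard_le_ncard_of_injOn (fun p => p.1 + g p.2) ?_ ?_ (Set.toFinite S)
  · rintro ⟨h, θ⟩ ⟨hh, hθ, hθR⟩
    exact hS θ _ hθR ((hg θ hθ).add_kernel hh)
  · rintro ⟨h, θ⟩ ⟨hh, hθ, hθR⟩ ⟨k, η⟩ ⟨hk, hη, hηR⟩ heq
    dsimp only at heq hh hθ hθR hk hη hηR
    have h1 : θ = η := ((hg θ hθ).add_kernel hh).unique hR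
      (heq ▸ (hg η hη).add_kernel hk) hθR hηR
    subst h1
    rw [add_left_inj] at heq
    rw [heq]

/-- Principal arguments lift each point of the Bohr set into the unit ball, and two elements with a
common lift differ by an element of the kernel. -/
theorem ncard_carrier_le (hfin : {θ | θ ∈ D.lifts ∧ ‖θ‖ ≤ 1}.Finite) :
    D.carrier.ncard ≤ Nat.card D.kernel * {θ | θ ∈ D.lifts ∧ ‖θ‖ ≤ 1}.ncard := by
  choose! g hg using fun θ (h : θ ∈ D.lifts) => h
  have hcard : Nat.card D.kernel = (D.kernel : Set G).ncard := rfl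
  have hsub : D.carrier ⊆ (fun p : G × (D.freq → ℝ) => p.1 + g p.2) ''
      ((D.kernel : Set G) ×ˢ {θ | θ ∈ D.lifts ∧ ‖θ‖ ≤ 1}) := by
    intro x hx
    obtain ⟨θ, hθ, hθ1⟩ := exists_isLift_of_mem_carrier hx
    exact ⟨(x - g θ, θ), ⟨hθ.sub_mem_kernel (hg θ ⟨x, hθ⟩), ⟨x, hθ⟩, hθ1⟩, by simp⟩
  rw [hcard, ← Set.ncard_prod]
  exact (Set.ncard_le_ncard hsub).trans
    (Set.ncard_image_le ((Set.toFinite (D.kernel : Set G)).prod hfin))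

/-- A Bohr set whose lifts have small growth contains a large proper coset progression. -/
theorem exists_cosetProgression {d : ℕ} (hR : ∀ γ, (3 * (d : ℝ) + 1) * D.angle γ < Real.pi)
    (hlt : {θ | θ ∈ D.lifts ∧ ‖θ‖ ≤ 3 * (d : ℝ) + 1}.ncard
      < 2 ^ d * {θ | θ ∈ D.lifts ∧ ‖θ‖ ≤ 1}.ncard) :
    ∃ M : CosetProgression G d, M.IsProper ∧ M.carrier ⊆ D.carrier ∧
      D.carrier.ncard ≤ d ^ (3 * d) * M.carrier.ncard := by
  have hfin := finite_lifts hR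
  have hd : (0 : ℝ) ≤ d := d.cast_nonneg
  obtain ⟨v, N, hv, hN, hle, hinj, hcard⟩ := exists_progression_of_ncard_lt hfin hlt
  choose x hx using hv
  let M : CosetProgression G d := ⟨D.kernel, 0, x, N, hN⟩
  have hlift : ∀ p, D.IsLift (∑ i, (p.2 i : ℕ) • v i) (M.point p) := fun p => by
    have := (IsLift.sum_nsmul (s := Finset.univ) (l := fun i => (p.2 i : ℕ)) hx).add_kernel p.1.2
    simpa [M, CosetProgression.point] using this
  -- Equal points have equal short lifts, so properness in `L` determines the coordinates, and then
  -- the kernel part.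
  have hproper : M.IsProper := by
    intro p q hpq
    have h2 : p.2 = q.2 := hinj ((hlift p).unique hR (hpq ▸ hlift q)
      ((hle p.2).trans (by linarith)) ((hle q.2).trans (by linarith)))
    refine Prod.ext (Subtype.ext ?_) h2
    simpa [M, CosetProgression.point, h2] using hpq
  refine ⟨M, hproper, ?_, ?_⟩
  · rintro _ ⟨p, rfl⟩ γ
    simpa using (hlift p).norm_one_sub_le one_pos (by simpa using hle p.2) γ
  · have hM : M.carrier.ncard = Nat.card D.kernel * ∏ i, N i := by
      rw [CosetProgression.carrier, ← Set.image_univ, Set.ncard_image_of_injective _ hproper,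
        Set.ncard_univ, Nat.card_prod, Nat.card_pi]
      simp [M]
    rw [hM, mul_left_comm]
    exact (ncard_carrier_le (hfin.subset fun θ hθ => ⟨hθ.1, hθ.2.trans (by linarith)⟩)).trans
      (Nat.mul_le_mul_left _ hcard)

end BohrSet

/-! ### ### From growth of the Bohr set to growth of its lifts -/

theorem mainTheorem7 :
    ∃ C : ℝ, 0 < C ∧
      ∀ (G : Type*) [AddCommGroup G] [Finite G] (B : BohrSet G) (d : ℕ) (δ : ℝ)
        (hδ : 0 < δ) (_ : δ < 1 / (4 * (3 * (d : ℝ) + 1)))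
        (_ : haarProb (B.dilate ((3 * (d : ℝ) + 1) * δ) (dilation_pos d hδ)).carrier
          < 2 ^ d * haarProb (B.dilate δ hδ).carrier),
        ∃ M : CosetProgression G d,
          M.IsProper ∧ M.carrier ⊆ (B.dilate δ hδ).carrier ∧
            Real.exp (-(C * (d * Real.log d))) ≤ (B.dilate δ hδ).beta M.carrier := by
  refine ⟨3, by norm_num, fun G _ _ B d δ hδ hδd hgrowth => ?_⟩
  have hGpos : (0 : ℝ) < Nat.card G := by exact_mod_cast Nat.card_pos
  have hd0 : (0 : ℝ) ≤ d := d.cast_nonneg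
  set D := B.dilate δ hδ
  have : Finite (AddChar G Circle) := Finite.of_equiv _ AddChar.circleEquivComplex.symm.toEquiv
  have : Fintype D.freq := Fintype.ofFinite _
  have hwidth : ∀ γ : D.freq, D.width γ ≤ δ * B.width γ := fun γ => min_le_left _ _
  -- Jordan's inequality gives `D.angle γ ≤ π δ`, so smallness of `δ` excludes wrap-around up to
  -- radius `3d+1`.
  have hR : ∀ γ, (3 * (d : ℝ) + 1) * D.angle γ < Real.pi := by
    intro γ
    have h1 : D.width γ ≤ 2 * δ := (hwidth γ).trans (by
      have := mul_le_mul_of_nonneg_left (B.width_le_two γ) hδ.le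
      linarith)
    rw [lt_div_iff₀ (by positivity)] at hδd
    calc (3 * (d : ℝ) + 1) * D.angle γ
        ≤ (3 * (d : ℝ) + 1) * (Real.pi / 2 * (2 * δ)) := by
          gcongr
          exact (BohrSet.angle_le γ).trans (by gcongr)
      _ = Real.pi * ((3 * (d : ℝ) + 1) * δ) := by ring
      _ < Real.pi * 1 := by
          refine mul_lt_mul_of_pos_left ?_ Real.pi_pos
          linarith [dilation_pos d hδ]
      _ = Real.pi := mul_one _
  have hgrowth' : (B.dilate ((3 * (d : ℝ) + 1) * δ) (dilation_pos d hδ)).carrier.ncard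
      < 2 ^ d * D.carrier.ncard := by
    unfold haarProb at hgrowth
    rw [← mul_div_assoc, div_lt_div_iff_of_pos_right hGpos] at hgrowth
    exact_mod_cast hgrowth
  have hlower := BohrSet.card_kernel_mul_ncard_lifts_le hR
    (S := (B.dilate ((3 * (d : ℝ) + 1) * δ) (dilation_pos d hδ)).carrier) (by
      intro θ x hθ hx γ
      have h1 := hx.norm_one_sub_le (n := 3 * d + 1) (by omega) (by push_cast; exact hθ) γ
      push_cast at h1
      refine le_min (h1.trans ?_) ?_
      · rw [mul_assoc]
        exact mul_le_mul_of_nonneg_left (hwidth γ) (by positivity)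
      -- The cap `2` on the dilated width is harmless: no chord is longer.
      · refine (norm_sub_le _ _).trans ?_
        rw [norm_one, Circle.norm_coe]
        norm_num)
  have hupper := BohrSet.ncard_carrier_le ((BohrSet.finite_lifts hR).subset
    fun θ hθ => ⟨hθ.1, hθ.2.trans (by linarith)⟩)
  obtain ⟨M, hproper, hsub, hcard⟩ := BohrSet.exists_cosetProgression hR (by
    -- The factor `|K|` occurs in both counts and cancels.
    refine lt_of_mul_lt_mul_left (a := Nat.card D.kernel) ?_ (Nat.zero_le _)
    calc _ ≤ _ := hlower
      _ < 2 ^ d * D.carrier.ncard := hgrowth'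
      _ ≤ 2 ^ d * _ := Nat.mul_le_mul_left _ hupper
      _ = _ := by ring)
  refine ⟨M, hproper, hsub, ?_⟩
  -- For `d = 0` both dilates are `B_δ`, and the growth hypothesis is a strict inequality of a
  -- number with itself.
  have hd1 : 0 < d := by
    rcases Nat.eq_zero_or_pos d with rfl | h
    · simp [D] at hgrowth
    · exact h
  have hDpos : 0 < D.carrier.ncard := Nat.pos_of_mul_pos_left (hgrowth'.pos)
  have hexp : Real.exp (-(3 * (d * Real.log d))) = ((d ^ (3 * d) : ℕ) : ℝ)⁻¹ := by
    have hdpos : (0 : ℝ) < d := by exact_mod_cast hd1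
    rw [Real.exp_neg, ← mul_assoc, mul_comm, Real.exp_mul, Real.exp_log hdpos]
    norm_cast
  rw [hexp, BohrSet.beta, Set.inter_eq_left.mpr hsub, haarProb, haarProb,
    div_div_div_cancel_right₀ hGpos.ne', inv_le_iff_one_le_mul₀ (by positivity), div_mul_eq_mul_div,
    one_le_div (by exact_mod_cast hDpos)]
  rw [mul_comm]
  exact_mod_cast hcard
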